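/- Let $p,r,s>0$. Let $G_r$ be a random variable with the standard gamma density $\frac{1}{\Gamma(r)}x^{r-1}e^{-x}$, $x>0$, and let $B_{r,s}$ be a random variable with the beta density $\frac{\Gamma(r+s)}{\Gamma(r)\Gamma(s)}y^{r-1}(1-y)^{s-1}$, $0<y<1$. For $\alpha>0$ and a real random variable $X$ with law $F$ and $0<\mathbb{E}|X|^\alpha<\infty$, let $X^{(\alpha)}$ denote a random variable having the $\alpha$-power bias distribution of $X$, that is, the law $dF^{(\alpha)}(x)=\frac{|x|^\alpha}{\mathbb{E}|X|^\alpha}\,dF(x)$. Then a non-negative random variable $W$ has the distribution of $c\,G_r^p$ for some constant $c>0$ if and only if $0<\mathbb{E}W^{s/p}<\infty$ and $$W\stackrel{d}{=}B_{r,s}^p\,W^{(s/p)},$$ where $B_{r,s}$ is independent of $W^{(s/p)}$. -/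

import Mathlib

open MeasureTheory ProbabilityTheory

/-- The `α`-power bias distribution of a law `μ` on `ℝ`: the law with density
`x ↦ |x| ^ α / ∫ |y| ^ α dμ(y)` with respect to `μ`. It is meaningful (a probability law) when
`0 < ∫ |y| ^ α dμ(y) < ∞`. -/
noncomputable def powerBias (α : ℝ) (μ : Measure ℝ) : Measure ℝ :=
  μ.withDensity fun x => ENNReal.ofReal (|x| ^ α / ∫ y, |y| ^ α ∂μ)

/-!
Write `a = s / p` and `M t = E[W ^ t]`. Taking moments in `W = B ^ p W^(a)` gives the functional
equation `M t = E[B ^ (p t)] * M (t + a) / M a`, in which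
`E[B ^ u] = Γ(r + u) Γ(r + s) / (Γ(r) Γ(r + s + u))`. The moments
`c ^ t Γ(r + p t) / Γ(r)` of `c G_r ^ p` satisfy it
(`rpowMoment_map_gammaMeasure_eq_beta_mul`). As a law on `(0, ∞)` is determined by its moments of
orders near `0` (`measure_eq_of_rpowMoment_eq`, by analyticity of the moment generating function of
`log W`), the law of `c G_r ^ p` is a fixed point.

Conversely, let `W` be a fixed point. It has no atom at `0`, because the biased law has none, and the
functional equation makes all moments of nonnegative order finite. The integer multiples of `a` alone
would not determine the law, as the moment problem may be indeterminate. But `log M` is convex and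
solves the difference equation `log M (t + a) - log M t = log M a - log E[B ^ (p t)]`, whose right
side has increments along `a ℕ` that tend to `0` (`tendsto_log_Gamma_second_difference`). As in the
Bohr–Mollerup theorem such a solution is unique (`eq_of_convexOn_of_add_sub_eq`). Hence, for the `c`
that gives the right value of `M a`, the function `M` is the moment function of `c G_r ^ p` at all
orders `t ≥ 0`, and by the functional equation also at orders slightly below `0`.
-/

open Set Filter Topology
open scoped ENNReal

/-! ### Real moments of gamma and beta laws -/

/-- The moment `∫ x ^ t dμ(x)` of real order `t`, with values in `[0, ∞]`. It is meant for measures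
carried by `(0, ∞)`, where it is the Mellin transform of `μ`, and `∞` means that the moment does
not exist. -/
noncomputable def rpowMoment (μ : Measure ℝ) (t : ℝ) : ℝ≥0∞ :=
  ∫⁻ x, ENNReal.ofReal (x ^ t) ∂μ

lemma rpowMoment_zero (μ : Measure ℝ) [IsProbabilityMeasure μ] : rpowMoment μ 0 = 1 := by
  simp [rpowMoment]

lemma rpowMoment_pos {μ : Measure ℝ} [NeZero μ] (hpos : ∀ᵐ x ∂μ, 0 < x) (t : ℝ) :
    0 < rpowMoment μ t := by
  rw [rpowMoment, pos_iff_ne_zero, Ne, lintegral_eq_zero_iff (by fun_prop)]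
  intro h
  obtain ⟨x, hx, hx0⟩ := (hpos.and h).exists
  exact (ENNReal.ofReal_pos.2 (Real.rpow_pos_of_pos hx t)).ne' hx0

/-- `x ^ t` times the gamma density of shape `r` is, up to the quotient of the normalizing constants,
the gamma density of shape `r + t`. -/
lemma rpowMoment_gammaMeasure {r t : ℝ} (hr : 0 < r) (ht : 0 < r + t) :
    rpowMoment (gammaMeasure r 1) t = ENNReal.ofReal (Real.Gamma (r + t) / Real.Gamma r) := by
  have key : ∀ᵐ x : ℝ, gammaPDF r 1 x * ENNReal.ofReal (x ^ t) =
      ENNReal.ofReal (Real.Gamma (r + t) / Real.Gamma r) * gammaPDF (r + t) 1 x := by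
    filter_upwards [Measure.ae_ne volume (0 : ℝ)] with x hx
    rcases hx.lt_or_gt with h | h
    · simp [gammaPDF_of_neg h]
    · have h1 := Real.Gamma_pos_of_pos hr
      have h2 := Real.Gamma_pos_of_pos ht
      rw [gammaPDF_of_nonneg h.le, gammaPDF_of_nonneg h.le, ← ENNReal.ofReal_mul (by positivity),
        ← ENNReal.ofReal_mul (by positivity), show r + t - 1 = (r - 1) + t by ring,
        Real.rpow_add h]
      congr 1
      simp only [Real.one_rpow]
      field_simp
  have hm : Measurable (gammaPDF r 1) := (measurable_gammaPDFReal r 1).ennreal_ofReal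
  have hm' : Measurable (gammaPDF (r + t) 1) := (measurable_gammaPDFReal _ 1).ennreal_ofReal
  rw [rpowMoment, gammaMeasure, lintegral_withDensity_eq_lintegral_mul _ hm (by fun_prop)]
  simp only [Pi.mul_apply]
  rw [lintegral_congr_ae key, lintegral_const_mul _ hm', lintegral_gammaPDF_eq_one ht one_pos,
    mul_one]

/-- `x ^ t` times the beta density with parameters `r, s` is, up to the quotient of the normalizing
constants, the beta density with parameters `r + t, s`. -/
lemma rpowMoment_betaMeasure {r s t : ℝ} (hr : 0 < r) (hs : 0 < s) (ht : 0 < r + t) :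
    rpowMoment (betaMeasure r s) t = ENNReal.ofReal (beta (r + t) s / beta r s) := by
  have key (x : ℝ) : betaPDF r s x * ENNReal.ofReal (x ^ t) =
      ENNReal.ofReal (beta (r + t) s / beta r s) * betaPDF (r + t) s x := by
    rcases le_or_gt x 0 with h | h
    · simp [betaPDF_eq_zero_of_nonpos h]
    rcases le_or_gt 1 x with h' | h'
    · simp [betaPDF_eq_zero_of_one_le h']
    have h1 := beta_pos hr hs
    have h2 := beta_pos ht hs
    have h3 : 0 < 1 - x := by linarith
    rw [betaPDF_of_pos_lt_one h h', betaPDF_of_pos_lt_one h h', ← ENNReal.ofReal_mul (by positivity),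
      ← ENNReal.ofReal_mul (by positivity), show r + t - 1 = (r - 1) + t by ring,
      Real.rpow_add h]
    congr 1
    field_simp
  have hm : Measurable (betaPDF r s) := (measurable_betaPDFReal r s).ennreal_ofReal
  have hm' : Measurable (betaPDF (r + t) s) := (measurable_betaPDFReal _ s).ennreal_ofReal
  rw [rpowMoment, betaMeasure, lintegral_withDensity_eq_lintegral_mul _ hm (by fun_prop)]
  simp only [Pi.mul_apply]
  rw [lintegral_congr key, lintegral_const_mul _ hm', lintegral_betaPDF_eq_one ht hs,
    mul_one]

/-! ### Moments of images, products and power biases -/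

lemma ae_pos_gammaMeasure (r : ℝ) : ∀ᵐ x ∂(gammaMeasure r 1), 0 < x := by
  have hm : Measurable (gammaPDF r 1) := (measurable_gammaPDFReal r 1).ennreal_ofReal
  rw [gammaMeasure, ae_withDensity_iff hm]
  filter_upwards [Measure.ae_ne volume (0 : ℝ)] with x hx h
  by_contra h'
  exact h (gammaPDF_of_neg (lt_of_le_of_ne (not_lt.1 h') hx))

lemma ae_pos_betaMeasure (r s : ℝ) : ∀ᵐ x ∂(betaMeasure r s), 0 < x := by
  have hm : Measurable (betaPDF r s) := (measurable_betaPDFReal r s).ennreal_ofReal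
  rw [betaMeasure, ae_withDensity_iff hm]
  filter_upwards with x h
  by_contra h'
  exact h (betaPDF_eq_zero_of_nonpos (not_lt.1 h'))

lemma rpowMoment_map_const_mul_rpow {μ : Measure ℝ} (hpos : ∀ᵐ x ∂μ, 0 < x) {c : ℝ} (hc : 0 < c)
    (p t : ℝ) :
    rpowMoment (μ.map fun x => c * x ^ p) t = ENNReal.ofReal (c ^ t) * rpowMoment μ (p * t) := by
  rw [rpowMoment, lintegral_map (by fun_prop) (by fun_prop), rpowMoment,
    ← lintegral_const_mul _ (by fun_prop)]
  refine lintegral_congr_ae ?_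
  filter_upwards [hpos] with x hx
  rw [Real.mul_rpow hc.le (by positivity), ENNReal.ofReal_mul (by positivity), Real.rpow_mul hx.le]

lemma rpowMoment_map_rpow_mul {β μ : Measure ℝ} [SFinite β] [SFinite μ] (hβ : ∀ᵐ x ∂β, 0 < x)
    (hμ : ∀ᵐ x ∂μ, 0 < x) (p t : ℝ) :
    rpowMoment ((β.prod μ).map fun z : ℝ × ℝ => z.1 ^ p * z.2) t =
      rpowMoment β (p * t) * rpowMoment μ t := by
  rw [rpowMoment, lintegral_map (by fun_prop) (by fun_prop), rpowMoment, rpowMoment,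
    ← lintegral_prod_mul (by fun_prop) (by fun_prop)]
  refine lintegral_congr_ae ?_
  filter_upwards [Measure.quasiMeasurePreserving_fst.ae hβ,
    Measure.quasiMeasurePreserving_snd.ae hμ] with z h1 h2
  rw [Real.mul_rpow (by positivity) h2.le, ENNReal.ofReal_mul (by positivity),
    Real.rpow_mul h1.le]

lemma ae_pos_map_rpow_mul {β μ : Measure ℝ} [SFinite β] [SFinite μ] (hβ : ∀ᵐ x ∂β, 0 < x)
    (hμ : ∀ᵐ x ∂μ, 0 < x) (p : ℝ) :
    ∀ᵐ x ∂((β.prod μ).map fun z : ℝ × ℝ => z.1 ^ p * z.2), 0 < x := by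
  rw [ae_map_iff (by fun_prop) measurableSet_Ioi]
  filter_upwards [Measure.quasiMeasurePreserving_fst.ae hβ,
    Measure.quasiMeasurePreserving_snd.ae hμ] with z h1 h2
  positivity

lemma ofReal_integral_abs_rpow {μ : Measure ℝ} (hμ : ∀ᵐ x ∂μ, 0 ≤ x) {a : ℝ}
    (hint : Integrable (fun x => |x| ^ a) μ) :
    ENNReal.ofReal (∫ x, |x| ^ a ∂μ) = rpowMoment μ a := by
  rw [ofReal_integral_eq_lintegral_ofReal hint (ae_of_all _ fun x => by positivity), rpowMoment]
  refine lintegral_congr_ae ?_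
  filter_upwards [hμ] with x hx
  rw [abs_of_nonneg hx]

/-- Biasing removes a possible atom at `0`, since the biasing density vanishes there. -/
lemma ae_pos_powerBias {μ : Measure ℝ} (hμ : ∀ᵐ x ∂μ, 0 ≤ x) {a : ℝ} (ha : 0 < a) :
    ∀ᵐ x ∂(powerBias a μ), 0 < x := by
  rw [powerBias, ae_withDensity_iff (by fun_prop)]
  filter_upwards [hμ] with x hx h
  refine lt_of_le_of_ne hx fun h0 => h ?_
  simp [← h0, Real.zero_rpow ha.ne']

lemma rpowMoment_powerBias {μ : Measure ℝ} (hμ : ∀ᵐ x ∂μ, 0 < x) {a : ℝ}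
    (hint : Integrable (fun x => |x| ^ a) μ) (h0 : 0 < ∫ x, |x| ^ a ∂μ) (t : ℝ) :
    rpowMoment (powerBias a μ) t = rpowMoment μ (t + a) / rpowMoment μ a := by
  rw [← ofReal_integral_abs_rpow (hμ.mono fun _ => le_of_lt) hint, rpowMoment, powerBias,
    lintegral_withDensity_eq_lintegral_mul _ (by fun_prop) (by fun_prop), rpowMoment,
    ENNReal.div_eq_inv_mul, ← lintegral_const_mul _ (by fun_prop)]
  refine lintegral_congr_ae ?_
  filter_upwards [hμ] with x hx
  rw [Pi.mul_apply, ← ENNReal.ofReal_inv_of_pos h0, ← ENNReal.ofReal_mul (by positivity),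
    ← ENNReal.ofReal_mul (by positivity), abs_of_pos hx, Real.rpow_add hx]
  congr 1
  ring

lemma integrable_rpow_of_rpowMoment_ne_top {μ : Measure ℝ} (hμ : ∀ᵐ x ∂μ, 0 < x) {t : ℝ}
    (h : rpowMoment μ t ≠ ∞) : Integrable (fun x => x ^ t) μ := by
  refine ⟨by fun_prop, ?_⟩
  rw [hasFiniteIntegral_iff_ofReal (hμ.mono fun x hx => Real.rpow_nonneg hx.le t)]
  exact h.lt_top

lemma rpowMoment_ne_top_of_integrable_abs {μ : Measure ℝ} (hμ : ∀ᵐ x ∂μ, 0 ≤ x) {a : ℝ}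
    (h : Integrable (fun x => |x| ^ a) μ) : rpowMoment μ a ≠ ∞ := by
  rw [← ofReal_integral_abs_rpow hμ h]
  exact ENNReal.ofReal_ne_top

/-- Moments are log-convex in their order, by Hölder's inequality. -/
lemma convexOn_log_rpowMoment {μ : Measure ℝ} [NeZero μ] (hμ : ∀ᵐ x ∂μ, 0 < x)
    {S : Set ℝ} (hS : Convex ℝ S) (hfin : ∀ t ∈ S, rpowMoment μ t ≠ ∞) :
    ConvexOn ℝ S fun t => Real.log (rpowMoment μ t).toReal := by
  refine ⟨hS, fun x hx y hy u v hu hv huv => ?_⟩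
  have hpos (z : ℝ) (hz : z ∈ S) : 0 < (rpowMoment μ z).toReal :=
    ENNReal.toReal_pos (rpowMoment_pos hμ z).ne' (hfin z hz)
  have hle : rpowMoment μ (u • x + v • y) ≤ rpowMoment μ x ^ u * rpowMoment μ y ^ v := by
    refine le_trans (le_of_eq ?_) (ENNReal.lintegral_mul_norm_pow_le
      (f := fun x' => ENNReal.ofReal (x' ^ x)) (g := fun x' => ENNReal.ofReal (x' ^ y))
      (by fun_prop) (by fun_prop) hu hv huv)
    refine lintegral_congr_ae ?_
    filter_upwards [hμ] with z hz
    rw [ENNReal.ofReal_rpow_of_pos (by positivity), ENNReal.ofReal_rpow_of_pos (by positivity),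
      ← ENNReal.ofReal_mul (by positivity), ← Real.rpow_mul hz.le, ← Real.rpow_mul hz.le,
      ← Real.rpow_add hz]
    simp [mul_comm]
  have hfx := ENNReal.rpow_ne_top_of_nonneg hu (hfin x hx)
  have hfy := ENNReal.rpow_ne_top_of_nonneg hv (hfin y hy)
  have hle' := ENNReal.toReal_mono (ENNReal.mul_ne_top hfx hfy) hle
  rw [ENNReal.toReal_mul, ← ENNReal.toReal_rpow, ← ENNReal.toReal_rpow] at hle'
  have h1 := hpos x hx
  have h2 := hpos y hy
  refine (Real.log_le_log (hpos _ (hS hx hy hu hv huv)) hle').trans (le_of_eq ?_)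
  rw [Real.log_mul (by positivity) (by positivity), Real.log_rpow h1, Real.log_rpow h2]
  rfl

/-! ### Uniqueness from moments near zero -/

/-- A law on `(0, ∞)` is determined by its moments of orders close to `0`, if these are finite: they
are the moment generating function of `log x`, whose analytic continuation to a vertical strip
contains the characteristic function of `log x`. -/
lemma measure_eq_of_rpowMoment_eq {μ ν : Measure ℝ} [IsProbabilityMeasure μ]
    [IsProbabilityMeasure ν] (hμ : ∀ᵐ x ∂μ, 0 < x) (hν : ∀ᵐ x ∂ν, 0 < x) {ε : ℝ} (hε : 0 < ε)
    (hfin : ∀ t ∈ Ioo (-ε) ε, rpowMoment μ t ≠ ∞)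
    (heq : ∀ t ∈ Ioo (-ε) ε, rpowMoment μ t = rpowMoment ν t) : μ = ν := by
  have hexp {ρ : Measure ℝ} (hρ : ∀ᵐ x ∂ρ, 0 < x) (t : ℝ) :
      (fun x => Real.exp (t * Real.log x)) =ᵐ[ρ] fun x => x ^ t := by
    filter_upwards [hρ] with x hx
    rw [Real.rpow_def_of_pos hx, mul_comm]
  have hset {ρ : Measure ℝ} (hρ : ∀ᵐ x ∂ρ, 0 < x)
      (hf : ∀ t ∈ Ioo (-ε) ε, rpowMoment ρ t ≠ ∞) :
      Ioo (-ε) ε ⊆ interior (integrableExpSet Real.log ρ) :=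
    interior_maximal (fun t ht => (integrable_congr (hexp hρ t)).2
      (integrable_rpow_of_rpowMoment_ne_top hρ (hf t ht))) isOpen_Ioo
  have hmgf {ρ : Measure ℝ} (hρ : ∀ᵐ x ∂ρ, 0 < x) (t : ℝ) :
      mgf Real.log ρ t = (rpowMoment ρ t).toReal := by
    rw [mgf, integral_congr_ae (hexp hρ t), integral_eq_lintegral_of_nonneg_ae
      (hρ.mono fun x hx => Real.rpow_nonneg hx.le t) (by fun_prop)]
    rfl
  have hfin' : ∀ t ∈ Ioo (-ε) ε, rpowMoment ν t ≠ ∞ := fun t ht => heq t ht ▸ hfin t ht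
  let U : Set ℂ := {z | z.re ∈ Ioo (-ε) ε}
  have hU : IsPreconnected U :=
    ((convex_Ioo (-ε) ε).linear_preimage Complex.reLm).isPreconnected
  have hX : AnalyticOnNhd ℂ (complexMGF Real.log μ) U :=
    analyticOnNhd_complexMGF.mono fun z hz => hset hμ hfin hz
  have hY : AnalyticOnNhd ℂ (complexMGF Real.log ν) U :=
    analyticOnNhd_complexMGF.mono fun z hz => hset hν hfin' hz
  -- The two transforms agree on the real segment `(-ε, ε)`, hence on the whole strip.
  have hfreq : ∃ᶠ z in 𝓝[≠] (0 : ℂ), complexMGF Real.log μ z = complexMGF Real.log ν z := by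
    have h_real : ∃ᶠ x : ℝ in 𝓝[≠] 0, complexMGF Real.log μ x = complexMGF Real.log ν x := by
      refine Eventually.frequently ?_
      filter_upwards [mem_nhdsWithin_of_mem_nhds (Ioo_mem_nhds (neg_neg_of_pos hε) hε)] with x hx
      rw [complexMGF_ofReal, complexMGF_ofReal, hmgf hμ, hmgf hν, heq x hx]
    have ht : Tendsto (fun x : ℝ => (x : ℂ)) (𝓝[≠] 0) (𝓝[≠] 0) := by
      refine tendsto_nhdsWithin_iff.2 ⟨?_, ?_⟩
      · exact (Complex.continuous_ofReal.tendsto' 0 0 (by simp)).mono_left nhdsWithin_le_nhds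
      · filter_upwards [self_mem_nhdsWithin] with x hx
        simpa using hx
    exact ht.frequently h_real
  have hEq := AnalyticOnNhd.eqOn_of_preconnected_of_frequently_eq hX hY hU
    (z₀ := 0) (by simp [U, hε]) hfreq
  have hlog : μ.map Real.log = ν.map Real.log := by
    have := Measure.isProbabilityMeasure_map (μ := μ) Real.measurable_log.aemeasurable
    have := Measure.isProbabilityMeasure_map (μ := ν) Real.measurable_log.aemeasurable
    refine Measure.ext_of_charFun ?_
    ext t
    rw [← complexMGF_mul_I Real.measurable_log.aemeasurable,
      ← complexMGF_mul_I Real.measurable_log.aemeasurable]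
    exact hEq (by simp [U, hε])
  have hback {ρ : Measure ℝ} (hρ : ∀ᵐ x ∂ρ, 0 < x) : (ρ.map Real.log).map Real.exp = ρ := by
    rw [Measure.map_map Real.measurable_exp Real.measurable_log]
    conv_rhs => rw [← Measure.map_id (μ := ρ)]
    refine Measure.map_congr ?_
    filter_upwards [hρ] with x hx
    simp [Real.exp_log hx]
  rw [← hback hμ, ← hback hν, hlog]

/-! ### Convex solutions of difference equations -/

/-- Krull's form of the Bohr–Mollerup theorem: a convex solution `f` of a difference equation
`f (t + a) - f t = φ t` is determined by `f 0` when the increments of `φ` along `a ℕ` tend to `0`.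
Both solutions agree on `a ℕ`, and convexity squeezes them between the same chords there. -/
lemma eq_of_convexOn_of_add_sub_eq {f g : ℝ → ℝ} {a : ℝ} (ha : 0 < a)
    (hf : ConvexOn ℝ (Ici 0) f) (hg : ConvexOn ℝ (Ici 0) g) (h0 : f 0 = g 0)
    (hfg : ∀ t, 0 ≤ t → f (t + a) - f t = g (t + a) - g t)
    (hlim : Tendsto (fun n : ℕ => (f (n * a + a + a) - f (n * a + a)) - (f (n * a + a) - f (n * a)))
      atTop (𝓝 0)) {t : ℝ} (ht : 0 ≤ t) : f t = g t := by
  have hper (n : ℕ) (t : ℝ) (ht : 0 ≤ t) : f (n * a + t) - g (n * a + t) = f t - g t := by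
    induction n with
    | zero => simp
    | succ n ih =>
      have := hfg (n * a + t) (by positivity)
      push_cast
      rw [show ((n : ℝ) + 1) * a + t = n * a + t + a by ring]
      linarith
  have sandwich {F : ℝ → ℝ} (hF : ConvexOn ℝ (Ici 0) F) {x u : ℝ} (hx : 0 ≤ x) (hu : 0 < u)
      (hua : u < a) : u / a * (F (x + a) - F x) ≤ F (x + a + u) - F (x + a) ∧
        F (x + a + u) - F (x + a) ≤ u / a * (F (x + a + a) - F (x + a)) := by
    have hxa : 0 ≤ x + a := by positivity
    have h1 := hF.slope_mono_adjacent (x := x) (y := x + a) (z := x + a + u) hx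
      (mem_Ici.2 (by positivity)) (by linarith) (by linarith)
    have h2 := hF.2 (mem_Ici.2 hxa) (mem_Ici.2 (show 0 ≤ x + a + a by positivity))
      (show 0 ≤ 1 - u / a by rw [sub_nonneg, div_le_one ha]; exact hua.le)
      (show 0 ≤ u / a by positivity) (by ring)
    have h3 : (1 - u / a) • (x + a) + (u / a) • (x + a + a) = x + a + u := by
      simp only [smul_eq_mul]; field_simp; ring
    rw [h3] at h2
    simp only [smul_eq_mul, add_sub_cancel_left] at h1 h2
    refine ⟨?_, by linarith⟩
    rw [le_div_iff₀ hu] at h1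
    calc u / a * (F (x + a) - F x) = (F (x + a) - F x) / a * u := by ring
      _ ≤ _ := h1
  have small (u : ℝ) (hu : 0 < u) (hua : u < a) : f u = g u := by
    -- `f` and `g` both lie between the same two chords over steps of length `a`, whose
    -- increments differ by the second difference of `f`.
    have hbound (n : ℕ) : |f u - g u| ≤
        (f (n * a + a + a) - f (n * a + a)) - (f (n * a + a) - f (n * a)) := by
      have hn : 0 ≤ (n : ℝ) * a := by positivity
      obtain ⟨f1, f2⟩ := sandwich hf hn hu hua
      obtain ⟨g1, g2⟩ := sandwich hg hn hu hua
      have e1 := hfg _ hn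
      have e2 := hfg (n * a + a) (by positivity)
      have e3 := hper (n + 1) u hu.le
      have e4 := hper (n + 1) 0 le_rfl
      push_cast at e3 e4
      rw [show ((n : ℝ) + 1) * a + u = n * a + a + u by ring] at e3
      rw [show ((n : ℝ) + 1) * a + 0 = n * a + a by ring] at e4
      rw [← e1] at g1
      rw [← e2] at g2
      set D := (f (n * a + a + a) - f (n * a + a)) - (f (n * a + a) - f (n * a)) with hD
      have hud : |f u - g u| ≤ u / a * D := by
        rw [hD, mul_sub, abs_le]
        constructor <;> linarith
      have hD0 : 0 ≤ D := by
        have := (abs_nonneg _).trans hud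
        exact nonneg_of_mul_nonneg_right this (by positivity)
      exact hud.trans (mul_le_of_le_one_left hD0 ((div_le_one ha).2 hua.le))
    have := ge_of_tendsto' hlim hbound
    exact sub_eq_zero.1 (abs_nonpos_iff.1 this)
  -- By periodicity of `f - g`, only the remainder of `t` modulo `a` matters.
  have hdecomp : t = (⌊t / a⌋₊ : ℝ) * a + (t - ⌊t / a⌋₊ * a) := by ring
  have h1 : (⌊t / a⌋₊ : ℝ) * a ≤ t := (le_div_iff₀ ha).1 (Nat.floor_le (by positivity))
  have h2 : t < ((⌊t / a⌋₊ : ℝ) + 1) * a := (div_lt_iff₀ ha).1 (Nat.lt_floor_add_one _)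
  have h3 := hper ⌊t / a⌋₊ (t - ⌊t / a⌋₊ * a) (by linarith)
  rw [← hdecomp] at h3
  have h4 : f (t - ⌊t / a⌋₊ * a) = g (t - ⌊t / a⌋₊ * a) := by
    rcases (sub_nonneg.2 h1).eq_or_lt with h | h
    · rw [← h, h0]
    · exact small _ h (by linarith)
  linarith

/-- Convexity of `log Γ` and `log Γ (u + 1) - log Γ u = log u` squeeze the increment
`log Γ (u + s) - log Γ u` between `s log (u - 1)` and `s log (u + s)`. -/
lemma tendsto_log_Gamma_second_difference {s : ℝ} (hs : 0 < s) :
    Tendsto (fun u : ℝ => (Real.log (Real.Gamma (u + s + s)) - Real.log (Real.Gamma (u + s))) -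
      (Real.log (Real.Gamma (u + s)) - Real.log (Real.Gamma u))) atTop (𝓝 0) := by
  have hstep {u : ℝ} (hu : 0 < u) :
      Real.log (Real.Gamma (u + 1)) - Real.log (Real.Gamma u) = Real.log u := by
    rw [Real.Gamma_add_one hu.ne', Real.log_mul hu.ne' (Real.Gamma_pos_of_pos hu).ne']
    ring
  have lower {u : ℝ} (hu : 1 < u) : s * Real.log (u - 1) ≤
      Real.log (Real.Gamma (u + s)) - Real.log (Real.Gamma u) := by
    have h := Real.convexOn_log_Gamma.slope_mono_adjacent (x := u - 1) (y := u) (z := u + s)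
      (mem_Ioi.2 (by linarith)) (mem_Ioi.2 (by linarith)) (by linarith) (by linarith)
    have h' := hstep (u := u - 1) (by linarith)
    simp only [sub_add_cancel] at h'
    simp only [Function.comp_apply, sub_sub_cancel, div_one, add_sub_cancel_left, h'] at h
    rw [le_div_iff₀ hs] at h
    linarith
  have upper {u : ℝ} (hu : 0 < u) :
      Real.log (Real.Gamma (u + s)) - Real.log (Real.Gamma u) ≤ s * Real.log (u + s) := by
    have h := Real.convexOn_log_Gamma.slope_mono_adjacent (x := u) (y := u + s) (z := u + s + 1)
      (mem_Ioi.2 (by linarith)) (mem_Ioi.2 (by linarith)) (by linarith) (by linarith)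
    have h' := hstep (u := u + s) (by linarith)
    simp only [Function.comp_apply, div_one, add_sub_cancel_left, h'] at h
    rw [div_le_iff₀ hs] at h
    linarith
  have hlog (b c : ℝ) : Tendsto (fun u : ℝ => s * (Real.log (u + b) - Real.log (u + c))) atTop
      (𝓝 0) := by
    have h (b : ℝ) := Real.tendsto_log_comp_add_sub_log b
    simpa using ((h b).sub (h c)).const_mul s
  refine tendsto_of_tendsto_of_tendsto_of_le_of_le' (hlog (s - 1) s) (hlog (s + s) (-1)) ?_ ?_
  · filter_upwards [eventually_gt_atTop 1] with u hu
    have h1 := lower (u := u + s) (by linarith)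
    have h2 := upper (u := u) (by linarith)
    rw [← add_sub_assoc, mul_sub]
    linarith
  · filter_upwards [eventually_gt_atTop 1] with u hu
    have h1 := lower (u := u) hu
    have h2 := upper (u := u + s) (by linarith)
    rw [← add_assoc, ← sub_eq_add_neg, mul_sub]
    linarith

/-! ### The fixed point equation for moments -/

lemma rpowMoment_map_gammaMeasure {r p c t : ℝ} (hr : 0 < r) (hc : 0 < c) (ht : 0 < r + p * t) :
    rpowMoment ((gammaMeasure r 1).map fun x => c * x ^ p) t =
      ENNReal.ofReal (c ^ t * (Real.Gamma (r + p * t) / Real.Gamma r)) := by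
  rw [rpowMoment_map_const_mul_rpow (ae_pos_gammaMeasure r) hc, rpowMoment_gammaMeasure hr ht,
    ENNReal.ofReal_mul (by positivity)]

lemma ae_pos_map_gammaMeasure {c : ℝ} (hc : 0 < c) (r p : ℝ) :
    ∀ᵐ x ∂((gammaMeasure r 1).map fun x => c * x ^ p), 0 < x := by
  rw [ae_map_iff (by fun_prop) measurableSet_Ioi]
  filter_upwards [ae_pos_gammaMeasure r] with x hx
  positivity

/-- The law of `c G_r ^ p` satisfies the moment form of the fixed point equation. -/
lemma rpowMoment_map_gammaMeasure_eq_beta_mul {r s p c t : ℝ} (hr : 0 < r) (hs : 0 < s)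
    (hp : 0 < p) (hc : 0 < c) (ht : 0 < r + p * t) {ν : Measure ℝ}
    (hν : ν = (gammaMeasure r 1).map fun x => c * x ^ p) :
    rpowMoment ν t =
      rpowMoment (betaMeasure r s) (p * t) * (rpowMoment ν (t + s / p) / rpowMoment ν (s / p)) := by
  have e1 : p * (t + s / p) = p * t + s := by field_simp
  have e2 : p * (s / p) = s := by field_simp
  have h1 := Real.Gamma_pos_of_pos hr
  have h2 := Real.Gamma_pos_of_pos ht
  have h3 := Real.Gamma_pos_of_pos (add_pos hr hs)
  have h4 := Real.Gamma_pos_of_pos (add_pos ht hs)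
  have h5 := Real.Gamma_pos_of_pos hs
  rw [hν, rpowMoment_betaMeasure hr hs ht, rpowMoment_map_gammaMeasure hr hc ht,
    rpowMoment_map_gammaMeasure hr hc (by rw [e1, ← add_assoc]; positivity),
    rpowMoment_map_gammaMeasure hr hc (by rw [e2]; positivity), e1, e2,
    ← ENNReal.ofReal_div_of_pos (by positivity),
    ← ENNReal.ofReal_mul (by unfold beta; positivity), Real.rpow_add hc]
  congr 1
  unfold beta
  rw [← add_assoc]
  field_simp

lemma ofReal_rpow_le_one_add {x t u : ℝ} (hx : 0 < x) (ht : 0 ≤ t) (htu : t ≤ u) :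
    ENNReal.ofReal (x ^ t) ≤ 1 + ENNReal.ofReal (x ^ u) := by
  rw [← ENNReal.ofReal_one, ← ENNReal.ofReal_add zero_le_one (by positivity)]
  refine ENNReal.ofReal_le_ofReal ?_
  rcases le_total x 1 with h | h
  · exact (Real.rpow_le_one hx.le h ht).trans (by simp; positivity)
  · exact (Real.rpow_le_rpow_of_exponent_le h htu).trans (by simp)

lemma rpowMoment_ne_top_of_le {μ : Measure ℝ} [IsProbabilityMeasure μ] (hμ : ∀ᵐ x ∂μ, 0 < x)
    {t u : ℝ} (ht : 0 ≤ t) (htu : t ≤ u) (h : rpowMoment μ u ≠ ∞) : rpowMoment μ t ≠ ∞ := by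
  refine ne_top_of_le_ne_top (b := 1 + rpowMoment μ u) (by simpa using h) ?_
  calc rpowMoment μ t ≤ ∫⁻ x, (1 + ENNReal.ofReal (x ^ u)) ∂μ :=
        lintegral_mono_ae (hμ.mono fun x hx => ofReal_rpow_le_one_add hx ht htu)
    _ = 1 + rpowMoment μ u := by
        rw [lintegral_add_left measurable_const]; simp [rpowMoment]

lemma rpowMoment_betaMeasure_ne_top {r s t : ℝ} (hr : 0 < r) (hs : 0 < s) (ht : 0 < r + t) :
    rpowMoment (betaMeasure r s) t ≠ ∞ := by
  rw [rpowMoment_betaMeasure hr hs ht]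
  exact ENNReal.ofReal_ne_top

lemma rpowMoment_betaMeasure_ne_zero {r s t : ℝ} (hr : 0 < r) (hs : 0 < s) :
    rpowMoment (betaMeasure r s) t ≠ 0 := by
  have := isProbabilityMeasureBeta hr hs
  exact (rpowMoment_pos (ae_pos_betaMeasure r s) t).ne'

/-- The moment form of the fixed point equation propagates finiteness from order `n * (s / p)` to
order `(n + 1) * (s / p)`, hence to all nonnegative orders. -/
lemma rpowMoment_ne_top_of_eq_beta_mul {r s p : ℝ} (hr : 0 < r) (hs : 0 < s) (hp : 0 < p)
    {μ : Measure ℝ} [IsProbabilityMeasure μ] (hμ : ∀ᵐ x ∂μ, 0 < x)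
    (hfin : rpowMoment μ (s / p) ≠ ∞)
    (hfe : ∀ t, 0 < r + p * t → rpowMoment μ t =
      rpowMoment (betaMeasure r s) (p * t) * (rpowMoment μ (t + s / p) / rpowMoment μ (s / p)))
    {t : ℝ} (ht : 0 ≤ t) : rpowMoment μ t ≠ ∞ := by
  have ha : 0 < s / p := by positivity
  have hnat (n : ℕ) : rpowMoment μ (n * (s / p)) ≠ ∞ := by
    induction n with
    | zero => simp [rpowMoment_zero]
    | succ n ih =>
      intro htop
      refine ih ?_
      push_cast at htop
      rw [hfe _ (by positivity), ← add_one_mul, htop, ENNReal.top_div_of_ne_top hfin,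
        ENNReal.mul_top (rpowMoment_betaMeasure_ne_zero hr hs)]
  obtain ⟨n, hn⟩ := exists_nat_ge (t / (s / p))
  exact rpowMoment_ne_top_of_le hμ ht ((div_le_iff₀ ha).1 hn) (hnat n)

/-- The difference equation satisfied by the logarithm of the moments of a fixed point. -/
lemma log_rpowMoment_sub {r s p : ℝ} (hr : 0 < r) (hs : 0 < s) (hp : 0 < p)
    {μ : Measure ℝ} [IsProbabilityMeasure μ] (hμ : ∀ᵐ x ∂μ, 0 < x)
    (hfin : rpowMoment μ (s / p) ≠ ∞)
    (hfe : ∀ t, 0 < r + p * t → rpowMoment μ t =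
      rpowMoment (betaMeasure r s) (p * t) * (rpowMoment μ (t + s / p) / rpowMoment μ (s / p)))
    {t : ℝ} (ht : 0 ≤ t) :
    Real.log (rpowMoment μ (t + s / p)).toReal - Real.log (rpowMoment μ t).toReal =
      Real.log (rpowMoment μ (s / p)).toReal -
        Real.log (rpowMoment (betaMeasure r s) (p * t)).toReal := by
  have hpos {u : ℝ} (hu : 0 ≤ u) : (rpowMoment μ u).toReal ≠ 0 :=
    (ENNReal.toReal_pos (rpowMoment_pos hμ u).ne'
      (rpowMoment_ne_top_of_eq_beta_mul hr hs hp hμ hfin hfe hu)).ne'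
  have hb : (rpowMoment (betaMeasure r s) (p * t)).toReal ≠ 0 :=
    (ENNReal.toReal_pos (rpowMoment_betaMeasure_ne_zero hr hs)
      (rpowMoment_betaMeasure_ne_top hr hs (by positivity))).ne'
  have h1 := hpos (u := t + s / p) (by positivity)
  have h2 := hpos (u := s / p) (by positivity)
  rw [hfe t (by positivity), ENNReal.toReal_mul, ENNReal.toReal_div,
    Real.log_mul hb (div_ne_zero h1 h2), Real.log_div h1 h2]
  ring

/-! ### Identification of the fixed points -/

/-- The moment form of the fixed point equation characterizes the laws of `c G_r ^ p`. -/
lemma exists_eq_map_gammaMeasure {r s p : ℝ} (hr : 0 < r) (hs : 0 < s) (hp : 0 < p)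
    {μ : Measure ℝ} [IsProbabilityMeasure μ] (hμ : ∀ᵐ x ∂μ, 0 < x)
    (hfin : rpowMoment μ (s / p) ≠ ∞)
    (hfe : ∀ t, 0 < r + p * t → rpowMoment μ t =
      rpowMoment (betaMeasure r s) (p * t) * (rpowMoment μ (t + s / p) / rpowMoment μ (s / p))) :
    ∃ c : ℝ, 0 < c ∧ μ = (gammaMeasure r 1).map fun x => c * x ^ p := by
  have ha : 0 < s / p := by positivity
  have epa : p * (s / p) = s := by field_simp
  have h1 := Real.Gamma_pos_of_pos hr
  have h3 := Real.Gamma_pos_of_pos (add_pos hr hs)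
  have hMa : 0 < (rpowMoment μ (s / p)).toReal :=
    ENNReal.toReal_pos (rpowMoment_pos hμ _).ne' hfin
  -- The scale `c` is the one for which `c G_r ^ p` has the same moment of order `s / p` as `μ`.
  obtain ⟨c, hc, hca⟩ : ∃ c : ℝ, 0 < c ∧ c ^ (s / p) * (Real.Gamma (r + s) / Real.Gamma r) =
      (rpowMoment μ (s / p)).toReal := by
    refine ⟨((rpowMoment μ (s / p)).toReal / (Real.Gamma (r + s) / Real.Gamma r)) ^ (s / p)⁻¹,
      by positivity, ?_⟩
    rw [Real.rpow_inv_rpow (by positivity) ha.ne', div_mul_cancel₀ _ (by positivity)]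
  refine ⟨c, hc, ?_⟩
  obtain ⟨ν, hν⟩ : ∃ ν, ν = (gammaMeasure r 1).map fun x => c * x ^ p := ⟨_, rfl⟩
  rw [← hν]
  have := isProbabilityMeasure_gammaMeasure hr one_pos
  have hνprob : IsProbabilityMeasure ν := hν ▸ Measure.isProbabilityMeasure_map (by fun_prop)
  have hνpos : ∀ᵐ x ∂ν, 0 < x := hν ▸ ae_pos_map_gammaMeasure hc r p
  have hνmom {t : ℝ} (ht : 0 < r + p * t) : rpowMoment ν t =
      ENNReal.ofReal (c ^ t * (Real.Gamma (r + p * t) / Real.Gamma r)) :=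
    hν ▸ rpowMoment_map_gammaMeasure hr hc ht
  have hνa : rpowMoment ν (s / p) = rpowMoment μ (s / p) := by
    rw [hνmom (by rw [epa]; positivity), epa, hca, ENNReal.ofReal_toReal hfin]
  have hνfin : rpowMoment ν (s / p) ≠ ∞ := hνa ▸ hfin
  have hνfe (t : ℝ) (ht : 0 < r + p * t) :=
    rpowMoment_map_gammaMeasure_eq_beta_mul hr hs hp hc ht hν
  have hμtop {t : ℝ} (ht : 0 ≤ t) : rpowMoment μ t ≠ ∞ :=
    rpowMoment_ne_top_of_eq_beta_mul hr hs hp hμ hfin hfe ht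
  have hνtop {t : ℝ} (ht : 0 ≤ t) : rpowMoment ν t ≠ ∞ :=
    rpowMoment_ne_top_of_eq_beta_mul hr hs hp hνpos hνfin hνfe ht
  have hlogν {t : ℝ} (ht : 0 ≤ t) : Real.log (rpowMoment ν t).toReal =
      t * Real.log c + (Real.log (Real.Gamma (r + p * t)) - Real.log (Real.Gamma r)) := by
    have h2 := Real.Gamma_pos_of_pos (show 0 < r + p * t by positivity)
    rw [hνmom (by positivity), ENNReal.toReal_ofReal (by positivity),
      Real.log_mul (by positivity) (by positivity), Real.log_rpow hc,
      Real.log_div h2.ne' h1.ne']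
  have hnonneg {t : ℝ} (ht : 0 ≤ t) : rpowMoment ν t = rpowMoment μ t := by
    have hlog := eq_of_convexOn_of_add_sub_eq
      (f := fun t => Real.log (rpowMoment ν t).toReal)
      (g := fun t => Real.log (rpowMoment μ t).toReal) ha
      (convexOn_log_rpowMoment hνpos (convex_Ici 0) fun t ht => hνtop ht)
      (convexOn_log_rpowMoment hμ (convex_Ici 0) fun t ht => hμtop ht)
      (by simp [rpowMoment_zero])
      (fun t ht => by
        rw [log_rpowMoment_sub hr hs hp hνpos hνfin hνfe ht,
          log_rpowMoment_sub hr hs hp hμ hfin hfe ht, hνa]) ?_ ht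
    · have e := Real.log_injOn_pos (ENNReal.toReal_pos (rpowMoment_pos hνpos t).ne' (hνtop ht))
        (ENNReal.toReal_pos (rpowMoment_pos hμ t).ne' (hμtop ht)) hlog
      exact (ENNReal.toReal_eq_toReal_iff' (hνtop ht) (hμtop ht)).1 e
    · have hu : Tendsto (fun n : ℕ => r + n * s) atTop atTop :=
        tendsto_atTop_add_const_left _ _
          (tendsto_natCast_atTop_atTop.atTop_mul_const hs)
      refine ((tendsto_log_Gamma_second_difference hs).comp hu).congr fun n => ?_
      rw [hlogν (by positivity), hlogν (by positivity), hlogν (by positivity)]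
      have i0 : r + p * (n * (s / p)) = r + n * s := by field_simp
      have i1 : r + p * (n * (s / p) + s / p) = r + n * s + s := by field_simp; ring
      have i2 : r + p * (n * (s / p) + s / p + s / p) = r + n * s + s + s := by field_simp; ring
      rw [i0, i1, i2]
      simp only [Function.comp_apply]
      ring
  -- For `t` in this range `t + s / p ≥ 0` and the beta moment of order `p * t > -r` is finite, so
  -- the equation transfers the equality of moments to small negative orders.
  have hε : 0 < min (s / p) (r / p) := by positivity
  have hrange {t : ℝ} (ht : t ∈ Ioo (-min (s / p) (r / p)) (min (s / p) (r / p))) :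
      0 < r + p * t ∧ 0 ≤ t + s / p := by
    have hl := min_le_left (s / p) (r / p)
    have hr' := min_le_right (s / p) (r / p)
    have h1 : -(r / p) < t := by linarith [ht.1]
    have h2 : p * (r / p) = r := by field_simp
    exact ⟨by nlinarith, by linarith [ht.1]⟩
  refine (measure_eq_of_rpowMoment_eq hνpos hμ hε (fun t ht => ?_) fun t ht => ?_).symm
  · rw [hνmom (hrange ht).1]
    exact ENNReal.ofReal_ne_top
  · rw [hνfe t (hrange ht).1, hfe t (hrange ht).1, hnonneg (hrange ht).2, hνa]

/-- The law of `c G_r ^ p` is a fixed point: both sides of the equation have the same moments of all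
orders `t > -r / p`. -/
lemma map_gammaMeasure_eq_map_rpow_mul_powerBias {r s p c : ℝ} (hr : 0 < r) (hs : 0 < s)
    (hp : 0 < p) (hc : 0 < c) {ν : Measure ℝ}
    (hν : ν = (gammaMeasure r 1).map fun x => c * x ^ p) :
    Integrable (fun x => |x| ^ (s / p)) ν ∧ 0 < ∫ x, |x| ^ (s / p) ∂ν ∧
      ν = ((betaMeasure r s).prod (powerBias (s / p) ν)).map fun z : ℝ × ℝ => z.1 ^ p * z.2 := by
  have := isProbabilityMeasure_gammaMeasure hr one_pos
  have := isProbabilityMeasureBeta hr hs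
  have hνprob : IsProbabilityMeasure ν := hν ▸ Measure.isProbabilityMeasure_map (by fun_prop)
  have hνpos : ∀ᵐ x ∂ν, 0 < x := hν ▸ ae_pos_map_gammaMeasure hc r p
  have hνnonneg : ∀ᵐ x ∂ν, 0 ≤ x := hνpos.mono fun _ => le_of_lt
  have epa : p * (s / p) = s := by field_simp
  have hfin {t : ℝ} (ht : 0 < r + p * t) : rpowMoment ν t ≠ ∞ := by
    rw [hν, rpowMoment_map_gammaMeasure hr hc ht]
    exact ENNReal.ofReal_ne_top
  have hfina : rpowMoment ν (s / p) ≠ ∞ := hfin (by rw [epa]; positivity)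
  have hint : Integrable (fun x => |x| ^ (s / p)) ν :=
    (integrable_rpow_of_rpowMoment_ne_top hνpos hfina).congr
      (hνpos.mono fun x hx => by simp [abs_of_pos hx])
  have hpos : 0 < ∫ x, |x| ^ (s / p) ∂ν := by
    rw [← ENNReal.ofReal_pos, ofReal_integral_abs_rpow hνnonneg hint]
    exact rpowMoment_pos hνpos _
  refine ⟨hint, hpos, ?_⟩
  have hbias : ∀ᵐ x ∂(powerBias (s / p) ν), 0 < x := ae_pos_powerBias hνnonneg (by positivity)
  have hbprob : IsProbabilityMeasure (powerBias (s / p) ν) := by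
    refine ⟨?_⟩
    have h := rpowMoment_powerBias hνpos hint hpos 0
    rw [zero_add, ENNReal.div_self (rpowMoment_pos hνpos _).ne' hfina] at h
    simpa [rpowMoment] using h
  have hprod := ae_pos_map_rpow_mul (ae_pos_betaMeasure r s) hbias p
  have : IsProbabilityMeasure
      (((betaMeasure r s).prod (powerBias (s / p) ν)).map fun z : ℝ × ℝ => z.1 ^ p * z.2) :=
    Measure.isProbabilityMeasure_map (by fun_prop)
  have hrange {t : ℝ} (ht : t ∈ Ioo (-(r / p)) (r / p)) : 0 < r + p * t := by
    have h2 : p * (r / p) = r := by field_simp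
    nlinarith [ht.1]
  refine measure_eq_of_rpowMoment_eq hνpos hprod (show 0 < r / p by positivity)
    (fun t ht => hfin (hrange ht)) fun t ht => ?_
  rw [rpowMoment_map_rpow_mul (ae_pos_betaMeasure r s) hbias,
    rpowMoment_powerBias hνpos hint hpos,
    ← rpowMoment_map_gammaMeasure_eq_beta_mul hr hs hp hc (hrange ht) hν]

theorem proposition4 {p r s : ℝ} (hp : 0 < p) (hr : 0 < r) (hs : 0 < s)
    {Ω : Type*} [MeasurableSpace Ω] (P : Measure Ω) [IsProbabilityMeasure P]
    (W : Ω → ℝ) (hW : AEMeasurable W P) (hW_nonneg : ∀ᵐ ω ∂P, 0 ≤ W ω) :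
    (∃ c : ℝ, 0 < c ∧ HasLaw W ((gammaMeasure r 1).map fun x => c * x ^ p) P) ↔
      (Integrable (fun ω => |W ω| ^ (s / p)) P ∧ 0 < ∫ ω, |W ω| ^ (s / p) ∂P ∧
        HasLaw W
          (((betaMeasure r s).prod (powerBias (s / p) (P.map W))).map
            fun z : ℝ × ℝ => z.1 ^ p * z.2) P) := by
  have := isProbabilityMeasureBeta hr hs
  have hprob : IsProbabilityMeasure (P.map W) := Measure.isProbabilityMeasure_map hW
  have hmeas : Measurable fun x : ℝ => |x| ^ (s / p) := by fun_prop
  have hint_iff : Integrable (fun ω => |W ω| ^ (s / p)) P ↔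
      Integrable (fun x : ℝ => |x| ^ (s / p)) (P.map W) := by
    rw [integrable_map_measure hmeas.aestronglyMeasurable hW]
    rfl
  have hint_eq : ∫ ω, |W ω| ^ (s / p) ∂P = ∫ x : ℝ, |x| ^ (s / p) ∂(P.map W) := by
    rw [integral_map hW hmeas.aestronglyMeasurable]
  rw [hint_iff, hint_eq]
  constructor
  · rintro ⟨c, hc, hlaw⟩
    obtain ⟨h1, h2, h3⟩ := map_gammaMeasure_eq_map_rpow_mul_powerBias hr hs hp hc hlaw.map_eq
    exact ⟨h1, h2, hW, h3⟩
  · rintro ⟨hint, hpos, hlaw⟩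
    have hnonneg : ∀ᵐ x ∂(P.map W), 0 ≤ x := (ae_map_iff hW measurableSet_Ici).2 hW_nonneg
    have hbias : ∀ᵐ x ∂(powerBias (s / p) (P.map W)), 0 < x :=
      ae_pos_powerBias hnonneg (by positivity)
    have : SFinite (powerBias (s / p) (P.map W)) := by unfold powerBias; infer_instance
    have hμ : ∀ᵐ x ∂(P.map W), 0 < x := by
      rw [hlaw.map_eq]
      exact ae_pos_map_rpow_mul (ae_pos_betaMeasure r s) hbias p
    obtain ⟨c, hc, h⟩ := exists_eq_map_gammaMeasure hr hs hp hμ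
      (rpowMoment_ne_top_of_integrable_abs hnonneg hint) fun t _ => by
        conv_lhs => rw [hlaw.map_eq]
        rw [rpowMoment_map_rpow_mul (ae_pos_betaMeasure r s) hbias,
          rpowMoment_powerBias hμ hint hpos]
    exact ⟨c, hc, hW, h⟩
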